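/- **Setting.** In a linear contract setting there are finite sets of actions $\mathcal A$, states $\mathcal Y$ and outcomes, an outcome map $o(a,y)$, outcome values $v(o)\in[0,1]$, pairwise distinct costs $c(a)\in[0,1]$, the policy space $\mathcal P=[0,1]$, and a finite nonempty set $\mathcal P_0\subseteq\mathcal P$ of benchmark policies. The Principal's and Agent's utilities are $V(a,p,y)=(1-p)\,v(o(a,y))$ and $U(a,p,y)=p\,v(o(a,y))-c(a)$. For a prior $\pi$ on $\mathcal Y$, $a^*(p,\pi)$ is an action maximizing the Agent's expected utility $\mathbb E_{y\sim\pi}U(a,p,y)$ and, among the maximizers, maximizing the Principal's expected utility $\mathbb E_{y\sim\pi}V(a,p,y)$ (remaining ties broken arbitrarily). **Interaction.** A mechanism $\sigma$ for horizon $T$ is randomized and nonresponsive: in round $t$, as a function of the past states $y_{1:t-1}$ and its own randomness, it produces a forecast $\pi_t\in\Delta(\mathcal Y)$, a policy $p_t\in\mathcal P$ and a recommendation $r_t\in\mathcal A$. (This includes the mechanisms with $p_t=\psi(\pi_t)$ and $r_t=a^*(p_t,\pi_t)$.) An Agent algorithm $\mathcal L$ for horizon $T$ draws $a_t$ from a distribution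 that is a function of $y_{1:t-1},a_{1:t-1},r_{1:t},p_{1:t}$. For $p_0\in\mathcal P_0$ the constant mechanism always offers $p_0$ and recommends $r^{p_0}_t=a^*(p_0,\pi_t)$, with the same forecasts. For given sequences $y,p,r$, with the actions generated by $\mathcal L$, let $$\mathrm{SwapReg}(y,p,r)=\mathbb E_{a}\Big[\max_{h:\mathcal P\times\mathcal A\times\mathcal A\to\mathcal A}\tfrac1T\sum_{t=1}^T\big(U(h(p_t,r_t,a_t),p_t,y_t)-U(a_t,p_t,y_t)\big)\Big],$$ $$\mathrm{NegReg}(y,p,r)=\tfrac1T\,\mathbb E_{a}\Big[\sum_{t=1}^TU(a_t,p_t,y_t)-\max_{h:\mathcal P\times\mathcal A\to\mathcal A}\sum_{t=1}^TU(h(p_t,r_t),p_t,y_t)\Big].$$ The Principal's policy regret is $$\mathrm{PR}(\sigma,\mathcal L,y)=\mathbb E_\sigma\Big[\max_{p_0\in\mathcal P_0}\mathbb E_{a,a^{p_0}}\,\tfrac1T\sum_{t=1}^T\big(V(a^{p_0}_t,p_0,y_t)-V(a_t,p_t,y_t)\big)\Big],$$ where $a$ and $a^{p_0}$ are the actions that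 $\mathcal L$ generates under $\sigma$ and under the constant mechanism $p_0$. A family $\mathcal L=(\mathcal L^T)_T$ *has vanishing regrets* against a family of mechanisms $\sigma=(\sigma^T)_T$ if there are sequences $\epsilon_{\rm swap}(T)\to0$ and $\epsilon_{\rm neg}(T)\to0$ such that for every $T$, every $y\in\mathcal Y^T$ and almost every realization of $\sigma^T$ one has $\mathrm{SwapReg}\le\epsilon_{\rm swap}(T)$ and $\mathrm{NegReg}\le\epsilon_{\rm neg}(T)$, both for the realized policies and recommendations of $\sigma^T$ and for those of every constant mechanism $p_0\in\mathcal P_0$. **Proposition.** There exist a linear contract setting with two actions, two states and two outcomes, and a constant $c>0$, such that for every choice of the tie-breaking in $a^*$ and every family of Principal mechanisms $\sigma=(\sigma^T)_T$ at least one of the following holds: 1. no family of Agent algorithms has vanishing regrets against $\sigma$; 2. there is a family $\mathcal L^*$ of Agent algorithms that has vanishing regrets against $\sigma$ and such that for all sufficiently large $T$ there is a state sequence $\bar y\in\mathcal Y^T$ with $\mathrm{PR}(\sigma^T,\mathcal L^{*T},\bar y)\ge c$. -/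

import Mathlib

open Filter Topology MeasureTheory

noncomputable section

/-- The space of linear contracts: the fraction of the outcome value paid to the Agent. -/
abbrev Policy : Type := unitInterval

/-- A linear contract setting with actions `A`, states `Y`, outcomes `O` and policy space `[0,1]`. -/
structure LinearContract (A Y O : Type) where
  /-- the outcome produced by an action in a state -/
  outcome : A → Y → O
  /-- the value of an outcome -/
  value : O → ℝ
  value_mem : ∀ o, value o ∈ Set.Icc (0 : ℝ) 1
  /-- the Agent's cost of an action -/
  cost : A → ℝ
  cost_mem : ∀ a, cost a ∈ Set.Icc (0 : ℝ) 1
  cost_injective : Function.Injective cost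
  /-- the finite set of benchmark policies -/
  benchmark : Finset Policy
  benchmark_nonempty : benchmark.Nonempty

/-- A (possibly randomized) nonresponsive Principal mechanism for horizon `T`: in each round,
given the states revealed so far and its own internal randomness `ω ∼ law`, it issues a forecast
of the state, a policy and a recommended action. It never sees the Agent's actions. Its own past
forecasts, policies and recommendations are functions of `ω` and of the state history, so
dependence on them is included. No relation between the three outputs is imposed; mechanisms of
the form `p_t = ψ(π_t)`, `r_t = a^*(p_t, π_t)` are a special case. -/
structure Mechanism (A Y : Type) [Fintype Y] (T : ℕ) where
  Ω : Type
  [measurableSpace : MeasurableSpace Ω]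
  law : Measure Ω
  [isProb : IsProbabilityMeasure law]
  forecast : (t : Fin T) → (Fin t → Y) → Ω → stdSimplex ℝ Y
  policy : (t : Fin T) → (Fin t → Y) → Ω → Policy
  recommend : (t : Fin T) → (Fin t → Y) → Ω → A
  measurable_forecast : ∀ t h, Measurable (forecast t h)
  measurable_policy : ∀ t h, Measurable (policy t h)
  measurableSet_recommend : ∀ t h a, MeasurableSet {ω | recommend t h ω = a}

attribute [instance] Mechanism.measurableSpace Mechanism.isProb

namespace Mechanism

variable {A Y : Type} [Fintype Y] {T : ℕ}

/-- The forecasts `π_{1:T}` realized on the state sequence `y`. -/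
def forecasts (σ : Mechanism A Y T) (y : Fin T → Y) (ω : σ.Ω) (t : Fin T) : stdSimplex ℝ Y :=
  σ.forecast t (Fin.take t t.isLt.le y) ω

/-- The policies `p_{1:T}` realized on the state sequence `y`. -/
def policies (σ : Mechanism A Y T) (y : Fin T → Y) (ω : σ.Ω) (t : Fin T) : Policy :=
  σ.policy t (Fin.take t t.isLt.le y) ω

/-- The recommendations `r_{1:T}` realized on the state sequence `y`. -/
def recommendations (σ : Mechanism A Y T) (y : Fin T → Y) (ω : σ.Ω) (t : Fin T) : A :=
  σ.recommend t (Fin.take t t.isLt.le y) ω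

end Mechanism

/-- An Agent learning algorithm for horizon `T`: the distribution of the action in round `t` is a
function of the past states, the past actions, and the past and current recommendations and
policies. -/
structure AgentAlg (A Y : Type) [Fintype A] (T : ℕ) where
  act : (t : Fin T) → (Fin t → Y) → (Fin t → A) → (Fin (t + 1) → A) → (Fin (t + 1) → Policy) →
    stdSimplex ℝ A
  measurable_act : ∀ t y a r, Measurable (act t y a r)

namespace AgentAlg

variable {A Y : Type} [Fintype A] {T : ℕ}

/-- The probability that the algorithm generates the actions `a`, when the states, policies and
recommendations are `y`, `p`, `r`. -/
def prob (L : AgentAlg A Y T) (y : Fin T → Y) (p : Fin T → Policy) (r a : Fin T → A) : ℝ :=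
  ∏ t : Fin T, (L.act t (Fin.take t t.isLt.le y) (Fin.take t t.isLt.le a)
    (Fin.take (t + 1) t.isLt r) (Fin.take (t + 1) t.isLt p) : A → ℝ) (a t)

/-- The expectation of `f a` over the generated action sequence `a`. -/
def expect (L : AgentAlg A Y T) (y : Fin T → Y) (p : Fin T → Policy) (r : Fin T → A)
    (f : (Fin T → A) → ℝ) : ℝ :=
  ∑ a : Fin T → A, L.prob y p r a * f a

end AgentAlg

namespace LinearContract

variable {A Y O : Type}

/-- The Principal's utility `V(a,p,y)`. -/
def V (S : LinearContract A Y O) (a : A) (p : Policy) (y : Y) : ℝ :=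
  (1 - (p : ℝ)) * S.value (S.outcome a y)

/-- The Agent's utility `U(a,p,y)`. -/
def U (S : LinearContract A Y O) (a : A) (p : Policy) (y : Y) : ℝ :=
  (p : ℝ) * S.value (S.outcome a y) - S.cost a

/-- The Principal's expected utility under the prior `π`. -/
def expV [Fintype Y] (S : LinearContract A Y O) (a : A) (p : Policy) (π : stdSimplex ℝ Y) : ℝ :=
  ∑ y, (π : Y → ℝ) y * S.V a p y

/-- The Agent's expected utility under the prior `π`. -/
def expU [Fintype Y] (S : LinearContract A Y O) (a : A) (p : Policy) (π : stdSimplex ℝ Y) : ℝ :=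
  ∑ y, (π : Y → ℝ) y * S.U a p y

/-- `a` is a best response of the Agent to `(p, π)`. -/
def IsBestResponse [Fintype Y] (S : LinearContract A Y O) (p : Policy) (π : stdSimplex ℝ Y)
    (a : A) : Prop :=
  ∀ b, S.expU b p π ≤ S.expU a p π

/-- A choice `a^*(p, π)` of a best response that is optimal for the Principal among all best
responses; remaining ties are broken arbitrarily (but measurably). -/
structure OptimisticResponse [Fintype Y] (S : LinearContract A Y O) where
  toFun : Policy → stdSimplex ℝ Y → A
  isBestResponse : ∀ p π, S.IsBestResponse p π (toFun p π)
  optimistic : ∀ p π b, S.IsBestResponse p π b → S.expV b p π ≤ S.expV (toFun p π) p π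
  measurableSet_eq : ∀ p a, MeasurableSet {π | toFun p π = a}

/-- The recommendations `r_t^{p₀} = a^*(p₀, π_t)` of the constant mechanism that always offers
`p₀`, under the forecasts realized by `σ`. -/
def constRecommendations [Fintype Y] {S : LinearContract A Y O} {T : ℕ}
    (astar : S.OptimisticResponse) (σ : Mechanism A Y T) (p₀ : Policy) (y : Fin T → Y) (ω : σ.Ω)
    (t : Fin T) : A :=
  astar.toFun p₀ (σ.forecasts y ω t)

section Regret

variable [Fintype A] {T : ℕ}

/-- The Agent's contextual swap regret on states `y`, policies `p` and recommendations `r`. -/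
def swapRegret (S : LinearContract A Y O) (L : AgentAlg A Y T) (y : Fin T → Y)
    (p : Fin T → Policy) (r : Fin T → A) : ℝ :=
  L.expect y p r fun a => ⨆ h : Policy → A → A → A,
    (1 / (T : ℝ)) * ∑ t, (S.U (h (p t) (r t) (a t)) (p t) (y t) - S.U (a t) (p t) (y t))

/-- The Agent's negative cross-swap-regret on states `y`, policies `p` and recommendations `r`. -/
def negRegret (S : LinearContract A Y O) (L : AgentAlg A Y T) (y : Fin T → Y)
    (p : Fin T → Policy) (r : Fin T → A) : ℝ :=
  (1 / (T : ℝ)) * L.expect y p r fun a => (∑ t, S.U (a t) (p t) (y t)) -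
    ⨆ h : Policy → A → A, ∑ t, S.U (h (p t) (r t)) (p t) (y t)

/-- The Principal's expected average utility on states `y`, when the policies and recommendations
are `p` and `r` and the Agent runs `L`. -/
def principalValue (S : LinearContract A Y O) (L : AgentAlg A Y T) (y : Fin T → Y)
    (p : Fin T → Policy) (r : Fin T → A) : ℝ :=
  L.expect y p r fun a => (1 / (T : ℝ)) * ∑ t, S.V (a t) (p t) (y t)

variable [Fintype Y]

/-- No contextual swap regret on the state sequence `y`, for almost every realization of `σ`:
both along the realized play and under every constant benchmark mechanism. -/
def NoContextualSwapRegret (S : LinearContract A Y O) (astar : S.OptimisticResponse)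
    (σ : Mechanism A Y T) (L : AgentAlg A Y T) (y : Fin T → Y) (ε : ℝ) : Prop :=
  ∀ᵐ ω ∂σ.law,
    S.swapRegret L y (σ.policies y ω) (σ.recommendations y ω) ≤ ε ∧
    ∀ p₀ ∈ S.benchmark,
      S.swapRegret L y (fun _ => p₀) (constRecommendations astar σ p₀ y ω) ≤ ε

/-- No negative cross-swap-regret on the state sequence `y`, for almost every realization of `σ`:
both along the realized play and under every constant benchmark mechanism. -/
def NoNegativeCrossSwapRegret (S : LinearContract A Y O) (astar : S.OptimisticResponse)
    (σ : Mechanism A Y T) (L : AgentAlg A Y T) (y : Fin T → Y) (ε : ℝ) : Prop :=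
  ∀ᵐ ω ∂σ.law,
    S.negRegret L y (σ.policies y ω) (σ.recommendations y ω) ≤ ε ∧
    ∀ p₀ ∈ S.benchmark,
      S.negRegret L y (fun _ => p₀) (constRecommendations astar σ p₀ y ω) ≤ ε

/-- The Principal's policy regret: the expectation over the mechanism's randomness of the largest
difference, over benchmark policies `p₀`, between the Principal's expected average utility under
the constant mechanism `p₀` and under the realized play. In each of the two scenarios the Agent's
actions are generated by `L` from the policies and recommendations of that scenario. -/
def policyRegret (S : LinearContract A Y O) (astar : S.OptimisticResponse)
    (σ : Mechanism A Y T) (L : AgentAlg A Y T) (y : Fin T → Y) : ℝ :=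
  ∫ ω, S.benchmark.sup' S.benchmark_nonempty (fun p₀ =>
    S.principalValue L y (fun _ => p₀) (constRecommendations astar σ p₀ y ω) -
      S.principalValue L y (σ.policies y ω) (σ.recommendations y ω)) ∂σ.law

/-- A family of Agent algorithms, one for each horizon, that has vanishing contextual swap regret
and vanishing negative cross-swap-regret against the family `σ`, uniformly over all state
sequences. -/
def VanishingRegrets (S : LinearContract A Y O) (astar : S.OptimisticResponse)
    (σ : ∀ T, Mechanism A Y T) (L : ∀ T, AgentAlg A Y T) : Prop :=
  ∃ εswap εneg : ℕ → ℝ, Tendsto εswap atTop (𝓝 0) ∧ Tendsto εneg atTop (𝓝 0) ∧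
    ∀ (T : ℕ) (y : Fin T → Y),
      S.NoContextualSwapRegret astar (σ T) (L T) y (εswap T) ∧
      S.NoNegativeCrossSwapRegret astar (σ T) (L T) y (εneg T)

end Regret

end LinearContract

end

/-!
Work costs `1 / 2` and yields value only in one of two states. Against uniformly random states an
action chosen without knowing the current state creates no welfare on average, so an Agent without
swap regret, whose utility is nearly nonnegative, leaves nothing for the Principal. Now fix a
benchmark policy `q` and inform the Agent of the state sequence, but let it use this knowledge only
in rounds with policy `q`: there it works in the good state instead of shirking and, whenever it
has gained from doing so, also works in the bad state. Its total gain stays bounded, so its regrets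
still vanish, and the extra work benefits the Principal. Under the constant policy `q` the
Principal earns about `(1 - q) / (4 * q)` per round; along the play of `σ` only the rounds with
policy `q` pay, at most `1 / 4` each on average. One of two benchmark policies is offered in at most
half of the rounds, so the play of `σ` earns at most `1 / 8` against that policy, less than
`3 / 20 ≤ (1 - q) / (4 * q)`.
-/

noncomputable section

open scoped BigOperators

section Prefix

variable {α : Type*} {T n : ℕ}

/-- The rounds before round `n`. Quantities that use only the data of these rounds are the
functions `f` with `DependsOn f (past n)`. -/
def past (n : ℕ) : Set (Fin T) :=
  {t | (t : ℕ) < n}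

@[simp]
theorem mem_past {t : Fin T} : t ∈ past n ↔ (t : ℕ) < n :=
  Iff.rfl

theorem past_mono {m n : ℕ} (h : m ≤ n) : past m ⊆ (past n : Set (Fin T)) :=
  fun _ ht => lt_of_lt_of_le (mem_past.1 ht) h

theorem mem_past_succ (t : Fin T) : t ∈ past (t + 1) :=
  mem_past.2 (Nat.lt_succ_self _)

theorem past_succ (t : Fin T) : (past (t + 1) : Set (Fin T)) = insert t (past t) := by
  ext s
  simp only [mem_past, Set.mem_insert_iff, Fin.ext_iff]
  omega

theorem eqOn_congr {ι : Type*} {u u' v v' : ι → α} {s : Set ι} (hu : Set.EqOn u u' s)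
    (hv : Set.EqOn v v' s) : Set.EqOn u v s ↔ Set.EqOn u' v' s :=
  ⟨fun h => hu.symm.trans (h.trans hv), fun h => hu.trans (h.trans hv.symm)⟩

theorem eqOn_past_length_iff {a b : Fin T → α} : Set.EqOn a b (past T) ↔ a = b :=
  ⟨fun h => funext fun t => h (mem_past.2 t.isLt), fun h => h ▸ Set.eqOn_refl _ _⟩

theorem eqOn_past_update (a : Fin T → α) (t : Fin T) (x : α) :
    Set.EqOn (Function.update a t x) a (past t) :=
  fun _ hs => Function.update_of_ne (fun h => lt_irrefl _ (mem_past.1 (h ▸ hs))) _ _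

theorem eqOn_past_succ_update_iff {u b : Fin T → α} {t : Fin T} {x : α} :
    Set.EqOn u (Function.update b t x) (past (t + 1)) ↔ Set.EqOn u b (past t) ∧ u t = x := by
  rw [past_succ, Set.insert_eq, Set.eqOn_union, Set.eqOn_singleton, Function.update_self,
    and_comm]
  exact and_congr_left' (eqOn_congr (Set.eqOn_refl u _) (eqOn_past_update b t x))

theorem take_eq_of_eqOn {a b : Fin T → α} (h : Set.EqOn a b (past n)) (hn : n ≤ T) :
    Fin.take n hn a = Fin.take n hn b :=
  funext fun i => h i.isLt

/-- A finite sequence extended to length `T` by an arbitrary value, used to feed truncated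
histories to functions of complete sequences. -/
def extendSeq [Nonempty α] (T : ℕ) {n : ℕ} (v : Fin n → α) (t : Fin T) : α :=
  if h : (t : ℕ) < n then v ⟨t, h⟩ else Classical.arbitrary α

theorem eqOn_extendSeq_take [Nonempty α] (hn : n ≤ T) (a : Fin T → α) :
    Set.EqOn (extendSeq T (Fin.take n hn a)) a (past n) :=
  fun _ hs => dif_pos hs

theorem measurable_extendSeq [Nonempty α] [MeasurableSpace α] (T : ℕ) {n : ℕ} :
    Measurable (extendSeq T : (Fin n → α) → Fin T → α) := by
  refine measurable_pi_iff.2 fun t => ?_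
  unfold extendSeq
  by_cases h : (t : ℕ) < n
  · simpa only [h, dite_true] using measurable_pi_apply _
  · simpa only [h, dite_false] using measurable_const

end Prefix

section Resampling

variable {ι A : Type*} [Fintype ι] [DecidableEq ι] [Fintype A]

theorem sum_sum_update {M : Type*} [AddCommMonoid M] (F : (ι → A) → M) (i : ι) :
    ∑ a, ∑ x, F (Function.update a i x) = Fintype.card A • ∑ a, F a := by
  have hswap : Function.Involutive
      fun z : (ι → A) × A => (Function.update z.1 i z.2, z.1 i) := by
    intro z
    simp
  calc ∑ a, ∑ x, F (Function.update a i x)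
      = ∑ z : (ι → A) × A, F (Function.update z.1 i z.2) := (Fintype.sum_prod_type' _).symm
    _ = ∑ z : (ι → A) × A, F z.1 := Equiv.sum_comp (hswap.toPerm _) fun z => F z.1
    _ = Fintype.card A • ∑ a, F a := by
      simp only [Fintype.sum_prod_type, Finset.sum_const, Finset.card_univ, Finset.sum_nsmul]

theorem sum_mul_congr_of_sum_update_eq {R : Type*} [Ring R] [NoZeroDivisors R]
    [CharZero R] {G k k' : (ι → A) → R} (i : ι)
    (hG : ∀ a x, G (Function.update a i x) = G a)
    (hk : ∀ a, ∑ x, k (Function.update a i x) = ∑ x, k' (Function.update a i x)) :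
    ∑ a, G a * k a = ∑ a, G a * k' a := by
  rcases isEmpty_or_nonempty A with hA | hA
  · have : IsEmpty (ι → A) := ⟨fun a => hA.elim (a i)⟩
    simp
  · have h : Fintype.card A • ∑ a, G a * k a = Fintype.card A • ∑ a, G a * k' a := by
      simp only [← sum_sum_update _ i, hG, ← Finset.mul_sum, hk]
    simpa only [nsmul_eq_mul, mul_eq_mul_left_iff, Nat.cast_eq_zero, Fintype.card_ne_zero,
      or_false] using h

end Resampling

section KernelSequence

variable {A : Type*} [Fintype A] {T : ℕ}

/-- The weights `κ t a` describe a random sequence generated step by step: `κ t a` is the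
conditional probability of `a t` given the entries of `a` before `t`. -/
structure IsKernelSequence (κ : Fin T → (Fin T → A) → ℝ) : Prop where
  dependsOn : ∀ t, DependsOn (κ t) (past (t + 1))
  sum_update : ∀ t a, ∑ x, κ t (Function.update a t x) = 1

theorem IsKernelSequence.sum_prod_mul_eq [Nonempty A] {κ : Fin T → (Fin T → A) → ℝ}
    (hκ : IsKernelSequence κ) {n : ℕ} (hn : n ≤ T) {f : (Fin T → A) → ℝ}
    (hf : DependsOn f (past n)) :
    ∑ a, (∏ t : Fin T, κ t a) * f a =
      ∑ a, (∏ t : Fin T, if (t : ℕ) < n then κ t a else (Fintype.card A : ℝ)⁻¹) * f a := by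
  induction hn using Nat.decreasingInduction with
  | self => simp only [Fin.is_lt, if_true]
  | of_succ m hm ih =>
    rw [ih (hf.mono (past_mono m.le_succ))]
    let t : Fin T := ⟨m, hm⟩
    let G a := (∏ s ∈ Finset.univ.erase t,
      if (s : ℕ) < m then κ s a else (Fintype.card A : ℝ)⁻¹) * f a
    have hG : ∀ a x, G (Function.update a t x) = G a := by
      intro a x
      have hupd := eqOn_past_update a t x
      refine congrArg₂ _ (Finset.prod_congr rfl fun s _ => ite_congr rfl (fun hs => ?_)
        fun _ => rfl) (hf fun s hs => hupd hs)
      exact hκ.dependsOn s fun i hi => hupd (past_mono (Nat.succ_le_of_lt hs) hi)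
    have huniform : ∀ a, ∑ x, κ t (Function.update a t x) = ∑ _x : A, (Fintype.card A : ℝ)⁻¹ := by
      intro a
      simp [hκ.sum_update]
    calc ∑ a, (∏ s : Fin T, if (s : ℕ) < m + 1 then κ s a else (Fintype.card A : ℝ)⁻¹) * f a
        = ∑ a, G a * κ t a := Finset.sum_congr rfl fun a _ => ?_
      _ = ∑ a, G a * (Fintype.card A : ℝ)⁻¹ := sum_mul_congr_of_sum_update_eq t hG huniform
      _ = _ := Finset.sum_congr rfl fun a _ => ?_
    · have hne : ∀ s ∈ Finset.univ.erase t, ((s : ℕ) < m + 1 ↔ (s : ℕ) < m) := by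
        intro s hs
        have := Fin.val_ne_of_ne (Finset.ne_of_mem_erase hs)
        simp only [t] at this
        omega
      rw [← Finset.mul_prod_erase _ _ (Finset.mem_univ t), if_pos (Nat.lt_succ_self m),
        Finset.prod_congr rfl fun s hs => if_congr (hne s hs) rfl rfl]
      ring
    · rw [← Finset.mul_prod_erase _ _ (Finset.mem_univ t), if_neg (lt_irrefl m)]
      ring

theorem IsKernelSequence.sum_prod [Nonempty A] {κ : Fin T → (Fin T → A) → ℝ}
    (hκ : IsKernelSequence κ) : ∑ a, ∏ t : Fin T, κ t a = 1 := by
  simpa using hκ.sum_prod_mul_eq (Nat.zero_le T) (f := fun _ => 1) fun _ _ _ => rfl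

end KernelSequence

@[to_additive]
theorem mul_prod_eq_last_of_succ {M : Type*} [CommMonoid M] :
    ∀ {T : ℕ} {f : Fin T → M} {g : Fin (T + 1) → M}, (∀ t, g t.succ = g t.castSucc * f t) →
      g 0 * ∏ t, f t = g (Fin.last T)
  | 0, _, _, _ => by simp
  | T + 1, f, g, h => by
    have hinit : g 0 * ∏ t : Fin T, f t.castSucc = g (Fin.last T).castSucc :=
      mul_prod_eq_last_of_succ (g := fun j => g j.castSucc) fun t => h t.castSucc
    rw [Fin.prod_univ_castSucc, ← mul_assoc, hinit, ← h, Fin.succ_last]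

section Disintegration

section Normalize

variable {A : Type*} [Fintype A]

/-- Rescales nonnegative weights to a probability vector; zero weights become uniform ones. -/
def normalizeOrUniform (v : A → ℝ) (x : A) : ℝ :=
  if ∑ i, v i = 0 then (Fintype.card A : ℝ)⁻¹ else v x / ∑ i, v i

theorem normalizeOrUniform_mem_stdSimplex [Nonempty A] {v : A → ℝ} (hv : ∀ x, 0 ≤ v x) :
    normalizeOrUniform v ∈ stdSimplex ℝ A := by
  unfold normalizeOrUniform
  split_ifs with h
  · exact ⟨fun _ => by positivity, by simp⟩
  · exact ⟨fun x => div_nonneg (hv x) (Finset.sum_nonneg fun i _ => hv i), by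
      rw [← Finset.sum_div, div_self h]⟩

theorem sum_mul_normalizeOrUniform {v : A → ℝ} (hv : ∀ x, 0 ≤ v x) (x : A) :
    (∑ i, v i) * normalizeOrUniform v x = v x := by
  unfold normalizeOrUniform
  split_ifs with h
  · rw [h, zero_mul, (Finset.sum_eq_zero_iff_of_nonneg fun i _ => hv i).1 h x (Finset.mem_univ x)]
  · exact mul_div_cancel₀ _ h

theorem measurable_normalizeOrUniform : Measurable (normalizeOrUniform : (A → ℝ) → A → ℝ) := by
  have hsum : Measurable fun v : A → ℝ => ∑ i, v i :=
    Finset.measurable_fun_sum _ fun i _ => measurable_pi_apply i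
  exact measurable_pi_iff.2 fun x => Measurable.ite (hsum (measurableSet_singleton 0))
    measurable_const ((measurable_pi_apply x).div hsum)

end Normalize

variable {A Ω : Type*} [Fintype Ω] {T : ℕ} (w : Ω → ℝ) (X : Ω → Fin T → A)

open Classical in
/-- The total weight of the sample points at which the sequence `X` starts with the first `n`
entries of `b`. -/
def prefixMass (n : ℕ) (b : Fin T → A) : ℝ :=
  ∑ ω, w ω * if Set.EqOn (X ω) b (past n) then 1 else 0

theorem prefixMass_nonneg {w : Ω → ℝ} (hw : ∀ ω, 0 ≤ w ω) (n : ℕ) (b : Fin T → A) :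
    0 ≤ prefixMass w X n b :=
  Finset.sum_nonneg fun ω _ => mul_nonneg (hw ω) (by split_ifs <;> norm_num)

theorem prefixMass_zero (b : Fin T → A) : prefixMass w X 0 b = ∑ ω, w ω := by
  simp [prefixMass, Set.EqOn]

theorem prefixMass_length [DecidableEq A] (b : Fin T → A) :
    prefixMass w X T b = ∑ ω, w ω * if X ω = b then 1 else 0 := by
  simp only [prefixMass, eqOn_past_length_iff]

variable [Fintype A]

theorem sum_prefixMass_update (t : Fin T) (b : Fin T → A) :
    ∑ x, prefixMass w X (t + 1) (Function.update b t x) = prefixMass w X t b := by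
  classical
  simp only [prefixMass, eqOn_past_succ_update_iff, ite_and]
  rw [Finset.sum_comm]
  simp

/-- The conditional distribution of the entry `t` of the random sequence `X`, given that the
earlier entries are those of `b`. -/
def condMass (t : Fin T) (b : Fin T → A) : A → ℝ :=
  normalizeOrUniform fun x => prefixMass w X (t + 1) (Function.update b t x)

theorem condMass_mem_stdSimplex [Nonempty A] {w : Ω → ℝ} (hw : ∀ ω, 0 ≤ w ω) (t : Fin T)
    (b : Fin T → A) : condMass w X t b ∈ stdSimplex ℝ A :=
  normalizeOrUniform_mem_stdSimplex fun _ => prefixMass_nonneg X hw _ _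

theorem prod_condMass {w : Ω → ℝ} (hw : w ∈ stdSimplex ℝ Ω) (b : Fin T → A) :
    ∏ t, condMass w X t b (b t) = prefixMass w X T b := by
  have hsucc : ∀ t : Fin T,
      prefixMass w X (t + 1) b = prefixMass w X t b * condMass w X t b (b t) := by
    intro t
    rw [← sum_prefixMass_update, condMass, sum_mul_normalizeOrUniform
      (fun _ => prefixMass_nonneg X hw.1 _ _), Function.update_eq_self]
  have hprod := mul_prod_eq_last_of_succ (g := fun j => prefixMass w X j b) hsucc
  simpa only [Fin.val_zero, prefixMass_zero, hw.2, one_mul, Fin.val_last] using hprod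

end Disintegration

namespace AgentAlg

variable {A Y : Type} [Fintype A] {T : ℕ} (L : AgentAlg A Y T)

section Basic

variable (y : Fin T → Y) (p : Fin T → Policy) (r : Fin T → A)

/-- The conditional probability of the action `a t`, given the history before round `t`. -/
def stepProb (t : Fin T) (a : Fin T → A) : ℝ :=
  (L.act t (Fin.take t t.isLt.le y) (Fin.take t t.isLt.le a)
    (Fin.take (t + 1) t.isLt r) (Fin.take (t + 1) t.isLt p) : A → ℝ) (a t)

theorem isKernelSequence_stepProb : IsKernelSequence (L.stepProb y p r) where
  dependsOn t a b hab := by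
    have hpast : Set.EqOn a b (past t) := fun s hs => hab s (past_mono (Nat.le_succ _) hs)
    simp only [stepProb, take_eq_of_eqOn hpast, hab t (mem_past_succ t)]
  sum_update t a := by
    simp only [stepProb, take_eq_of_eqOn (eqOn_past_update a t _), Function.update_self]
    exact (L.act t _ _ _ _).2.2

theorem measurable_stepProb (t : Fin T) (a : Fin T → A) :
    Measurable fun p => L.stepProb y p r t a :=
  (measurable_pi_apply (a t)).comp <| measurable_subtype_coe.comp <|
    (L.measurable_act t _ _ _).comp <| measurable_pi_iff.2 fun _ => measurable_pi_apply _

theorem prob_nonneg (a : Fin T → A) : 0 ≤ L.prob y p r a :=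
  Finset.prod_nonneg fun t _ => (L.act t _ _ _ _).2.1 _

theorem sum_prob [Nonempty A] : ∑ a, L.prob y p r a = 1 :=
  (L.isKernelSequence_stepProb y p r).sum_prod

theorem measurable_prob (a : Fin T → A) : Measurable fun p => L.prob y p r a :=
  Finset.measurable_fun_prod _ fun t _ => L.measurable_stepProb y r t a

variable {y p r} in
theorem expect_mono {f g : (Fin T → A) → ℝ} (h : ∀ a, f a ≤ g a) :
    L.expect y p r f ≤ L.expect y p r g :=
  Finset.sum_le_sum fun a _ => mul_le_mul_of_nonneg_left (h a) (L.prob_nonneg y p r a)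

theorem expect_add (f g : (Fin T → A) → ℝ) :
    L.expect y p r (fun a => f a + g a) = L.expect y p r f + L.expect y p r g := by
  simp only [expect, mul_add, Finset.sum_add_distrib]

theorem expect_const_mul (c : ℝ) (f : (Fin T → A) → ℝ) :
    L.expect y p r (fun a => c * f a) = c * L.expect y p r f := by
  simp only [expect, Finset.mul_sum, mul_left_comm]

theorem expect_sum {ι : Type*} (s : Finset ι) (f : ι → (Fin T → A) → ℝ) :
    L.expect y p r (fun a => ∑ i ∈ s, f i a) = ∑ i ∈ s, L.expect y p r (f i) := by
  simp only [expect, Finset.mul_sum]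
  exact Finset.sum_comm

theorem expect_const [Nonempty A] (c : ℝ) : L.expect y p r (fun _ => c) = c := by
  simp only [expect, ← Finset.sum_mul, sum_prob, one_mul]

end Basic

theorem expect_congr [Nonempty A] {y y' : Fin T → Y} {p p' : Fin T → Policy}
    {r r' : Fin T → A} {f : (Fin T → A) → ℝ} (t : Fin T) (hy : Set.EqOn y y' (past t))
    (hp : Set.EqOn p p' (past (t + 1))) (hr : Set.EqOn r r' (past (t + 1)))
    (hf : DependsOn f (past (t + 1))) :
    L.expect y p r f = L.expect y' p' r' f := by
  have hstep : ∀ s : Fin T, (s : ℕ) < t + 1 → ∀ a,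
      L.stepProb y p r s a = L.stepProb y' p' r' s a := by
    intro s hs a
    have hy := take_eq_of_eqOn (hy.mono (past_mono (Nat.le_of_lt_succ hs))) s.isLt.le
    have hp := take_eq_of_eqOn (hp.mono (past_mono hs)) s.isLt
    have hr := take_eq_of_eqOn (hr.mono (past_mono hs)) s.isLt
    simp only [stepProb, hy, hp, hr]
  refine ((L.isKernelSequence_stepProb y p r).sum_prod_mul_eq t.isLt hf).trans <|
    Eq.trans ?_ ((L.isKernelSequence_stepProb y' p' r').sum_prod_mul_eq t.isLt hf).symm
  exact Finset.sum_congr rfl fun a _ => congrArg (· * f a) <|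
    Finset.prod_congr rfl fun s _ => ite_congr rfl (fun hs => hstep s hs a) fun _ => rfl

end AgentAlg

/-- A rule that replaces each action of a sequence, given the data available to an Agent
algorithm and a memory state of type `M` that is updated once the state of the round is known. -/
structure Relabeling (A Y M : Type) [MeasurableSpace M] (T : ℕ) where
  /-- the memory before the first round -/
  start : M
  /-- the memory update, from the state, policy, recommendation and original action of a round -/
  step : Fin T → Y → Policy → A → A → M → M
  /-- the new action, from the policy, recommendation and original action of a round -/
  out : Fin T → Policy → A → A → M → A
  measurable_step : ∀ t y r a, Measurable fun x : Policy × M => step t y x.1 r a x.2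
  measurableSet_out : ∀ t r a b, MeasurableSet {x : Policy × M | out t x.1 r a x.2 = b}

namespace Relabeling

variable {A Y M : Type} [MeasurableSpace M] {T : ℕ} (Φ : Relabeling A Y M T)

section Apply

variable (y : Fin T → Y) (p : Fin T → Policy) (r a : Fin T → A)

/-- The memory states before each round and after the last one. -/
def memory : Fin (T + 1) → M :=
  Fin.induction Φ.start fun t m => Φ.step t (y t) (p t) (r t) (a t) m

@[simp]
theorem memory_succ (t : Fin T) : Φ.memory y p r a t.succ =
    Φ.step t (y t) (p t) (r t) (a t) (Φ.memory y p r a t.castSucc) :=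
  rfl

/-- The relabeled actions. -/
def apply (t : Fin T) : A :=
  Φ.out t (p t) (r t) (a t) (Φ.memory y p r a t.castSucc)

theorem measurable_memory (j : Fin (T + 1)) : Measurable fun p => Φ.memory y p r a j := by
  induction j using Fin.induction with
  | zero => exact measurable_const
  | succ t ih => exact (Φ.measurable_step t _ _ _).comp ((measurable_pi_apply t).prodMk ih)

theorem measurableSet_eqOn_apply [Countable A] (b : Fin T → A) (n : ℕ) :
    MeasurableSet {p | Set.EqOn (Φ.apply y p r a) b (past n)} := by
  have hround : ∀ t, MeasurableSet {p | Φ.apply y p r a t = b t} := fun t =>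
    ((measurable_pi_apply t).prodMk (Φ.measurable_memory y r a t.castSucc))
      (Φ.measurableSet_out t (r t) (a t) (b t))
  simp only [Set.EqOn, Set.ofPred_forall]
  exact MeasurableSet.iInter fun t => MeasurableSet.iInter fun _ => hround t

end Apply

variable {y y' : Fin T → Y} {p p' : Fin T → Policy} {r r' a a' : Fin T → A}

theorem memory_congr (j : Fin (T + 1)) (hy : Set.EqOn y y' (past j))
    (hp : Set.EqOn p p' (past j)) (hr : Set.EqOn r r' (past j)) (ha : Set.EqOn a a' (past j)) :
    Φ.memory y p r a j = Φ.memory y' p' r' a' j := by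
  induction j using Fin.induction with
  | zero => rfl
  | succ t ih =>
    have hpast : (past (t.castSucc : ℕ) : Set (Fin T)) ⊆ past (t.succ : ℕ) :=
      past_mono (Nat.le_succ _)
    have ht : t ∈ past (t.succ : ℕ) := mem_past_succ t
    rw [memory_succ, memory_succ, hy ht, hp ht, hr ht, ha ht,
      ih (hy.mono hpast) (hp.mono hpast) (hr.mono hpast) (ha.mono hpast)]

theorem apply_congr {t : Fin T} (hy : Set.EqOn y y' (past t))
    (hp : Set.EqOn p p' (past (t + 1))) (hr : Set.EqOn r r' (past (t + 1)))
    (ha : Set.EqOn a a' (past (t + 1))) : Φ.apply y p r a t = Φ.apply y' p' r' a' t := by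
  have hpast : (past t : Set (Fin T)) ⊆ past (t + 1) := past_mono (Nat.le_succ _)
  have ht := mem_past_succ t
  simp only [apply, hp ht, hr ht, ha ht, Φ.memory_congr t.castSucc hy (hp.mono hpast)
    (hr.mono hpast) (ha.mono hpast)]

theorem eqOn_apply {t : Fin T} (hy : Set.EqOn y y' (past t))
    (hp : Set.EqOn p p' (past (t + 1))) (hr : Set.EqOn r r' (past (t + 1)))
    (ha : Set.EqOn a a' (past (t + 1))) :
    Set.EqOn (Φ.apply y p r a) (Φ.apply y' p' r' a') (past (t + 1)) := fun s hs =>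
  have hst : (s : ℕ) ≤ t := Nat.le_of_lt_succ hs
  Φ.apply_congr (hy.mono (past_mono hst)) (hp.mono (past_mono hs)) (hr.mono (past_mono hs))
    (ha.mono (past_mono hs))

end Relabeling

namespace AgentAlg

variable {A Y M : Type} [Fintype A] [MeasurableSpace M] {T : ℕ}
  (L : AgentAlg A Y T) (Φ : Relabeling A Y M T)

theorem measurable_condMass (y : Fin T → Y) (r b : Fin T → A) (t : Fin T) :
    Measurable fun p => condMass (L.prob y p r) (Φ.apply y p r) t b := by
  refine measurable_normalizeOrUniform.comp <| measurable_pi_iff.2 fun x =>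
    Finset.measurable_fun_sum _ fun a _ => (L.measurable_prob y r a).mul ?_
  exact Measurable.ite (Φ.measurableSet_eqOn_apply y r a _ _) measurable_const measurable_const

variable [Nonempty A]

theorem condMass_congr {t : Fin T} {y y' : Fin T → Y} {p p' : Fin T → Policy}
    {r r' b b' : Fin T → A} (hy : Set.EqOn y y' (past t)) (hp : Set.EqOn p p' (past (t + 1)))
    (hr : Set.EqOn r r' (past (t + 1))) (hb : Set.EqOn b b' (past t)) :
    condMass (L.prob y p r) (Φ.apply y p r) t b =
      condMass (L.prob y' p' r') (Φ.apply y' p' r') t b' := by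
  classical
  unfold condMass
  congr 1 with x
  have hupd : Set.EqOn (Function.update b t x) (Function.update b' t x) (past (t + 1)) :=
    eqOn_past_succ_update_iff.2 ⟨(eqOn_past_update b t x).trans hb, Function.update_self ..⟩
  refine (L.expect_congr t hy hp hr fun a a' ha => ?_).trans <|
    Finset.sum_congr rfl fun a _ => congrArg _ (if_congr ?_ rfl rfl)
  · have ha : Set.EqOn a a' (past (t + 1)) := fun s hs => ha s hs
    have happly := Φ.eqOn_apply (Set.eqOn_refl y _) (Set.eqOn_refl p _) (Set.eqOn_refl r _) ha
    exact if_congr (eqOn_congr happly (Set.eqOn_refl _ _)) rfl rfl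
  · exact eqOn_congr (Φ.eqOn_apply hy hp hr (Set.eqOn_refl a _)) hupd

variable [Nonempty Y]

/-- The Agent algorithm that plays the relabeled actions of a simulated algorithm: it draws each
action from its conditional distribution given the earlier relabeled actions. -/
def relabel : AgentAlg A Y T where
  act t y b r p :=
    ⟨condMass (L.prob (extendSeq T y) (extendSeq T p) (extendSeq T r))
      (Φ.apply (extendSeq T y) (extendSeq T p) (extendSeq T r)) t (extendSeq T b),
      condMass_mem_stdSimplex _ (L.prob_nonneg _ _ _) t _⟩
  measurable_act t _ _ _ :=
    ((L.measurable_condMass Φ _ _ _ t).comp (measurable_extendSeq T)).subtype_mk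

theorem stepProb_relabel (y : Fin T → Y) (p : Fin T → Policy) (r b : Fin T → A) (t : Fin T) :
    (L.relabel Φ).stepProb y p r t b = condMass (L.prob y p r) (Φ.apply y p r) t b (b t) :=
  congrFun (L.condMass_congr Φ (eqOn_extendSeq_take _ y) (eqOn_extendSeq_take _ p)
    (eqOn_extendSeq_take _ r) (eqOn_extendSeq_take _ b)) (b t)

theorem expect_relabel (y : Fin T → Y) (p : Fin T → Policy) (r : Fin T → A)
    (f : (Fin T → A) → ℝ) :
    (L.relabel Φ).expect y p r f = L.expect y p r fun a => f (Φ.apply y p r a) := by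
  classical
  have hprob : ∀ b, (L.relabel Φ).prob y p r b =
      ∑ a, L.prob y p r a * if Φ.apply y p r a = b then 1 else 0 := by
    intro b
    rw [← prefixMass_length, ← prod_condMass _ ⟨L.prob_nonneg y p r, L.sum_prob y p r⟩]
    exact Finset.prod_congr rfl fun t _ => L.stepProb_relabel Φ y p r b t
  simp only [expect, hprob, Finset.sum_mul]
  rw [Finset.sum_comm]
  simp

end AgentAlg

theorem exists_le_integral_of_ae_le_expect {Ω ι : Type*} [MeasurableSpace Ω] {μ : Measure Ω}
    [IsProbabilityMeasure μ] {s : Finset ι} (hs : s.Nonempty) {f : ι → Ω → ℝ}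
    (hf : ∀ i ∈ s, Integrable (f i) μ) {c : ℝ} (hc : ∀ᵐ ω ∂μ, c ≤ 𝔼 i ∈ s, f i ω) :
    ∃ i ∈ s, c ≤ ∫ ω, f i ω ∂μ := by
  refine Finset.exists_le_of_le_expect hs ?_
  have hint : Integrable (fun ω => 𝔼 i ∈ s, f i ω) μ := by
    simp only [Finset.expect_eq_sum_div_card]
    exact (integrable_finsetSum s hf).div_const _
  calc c = ∫ _, c ∂μ := by simp
    _ ≤ ∫ ω, 𝔼 i ∈ s, f i ω ∂μ := integral_mono_ae (integrable_const c) hint hc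
    _ = 𝔼 i ∈ s, ∫ ω, f i ω ∂μ := by
      simp only [Finset.expect_eq_sum_div_card, integral_div, integral_finsetSum s hf]

namespace LinearContract

variable {A Y O : Type} (S : LinearContract A Y O)

theorem V_add_U (a : A) (p : Policy) (y : Y) :
    S.V a p y + S.U a p y = S.value (S.outcome a y) - S.cost a := by
  unfold V U
  ring

theorem V_mem_Icc (a : A) (p : Policy) (y : Y) : S.V a p y ∈ Set.Icc (0 : ℝ) 1 :=
  have hvalue := S.value_mem (S.outcome a y)
  ⟨mul_nonneg (sub_nonneg.2 p.2.2) hvalue.1,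
    mul_le_one₀ (sub_le_self _ p.2.1) hvalue.1 hvalue.2⟩

theorem abs_U_le_one (a : A) (p : Policy) (y : Y) : |S.U a p y| ≤ 1 := by
  have hvalue := S.value_mem (S.outcome a y)
  have hcost := S.cost_mem a
  have hpay : (p : ℝ) * S.value (S.outcome a y) ≤ 1 := mul_le_one₀ p.2.2 hvalue.1 hvalue.2
  have hpay_nonneg : 0 ≤ (p : ℝ) * S.value (S.outcome a y) := mul_nonneg p.2.1 hvalue.1
  rw [U, abs_le]
  constructor <;> linarith [hcost.1, hcost.2]

theorem measurable_V (a : A) (y : Y) : Measurable fun p => S.V a p y :=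
  (measurable_const.sub measurable_subtype_coe).mul_const _

theorem bddAbove_swap {T : ℕ} (y : Fin T → Y) (p : Fin T → Policy) (r a : Fin T → A) :
    BddAbove (Set.range fun h : Policy → A → A → A => (1 / (T : ℝ)) *
      ∑ t, (S.U (h (p t) (r t) (a t)) (p t) (y t) - S.U (a t) (p t) (y t))) := by
  refine ⟨(1 / (T : ℝ)) * ∑ _t : Fin T, 2, ?_⟩
  rintro _ ⟨h, rfl⟩
  refine mul_le_mul_of_nonneg_left (Finset.sum_le_sum fun t _ => ?_) (by positivity)
  linarith [(abs_le.1 (S.abs_U_le_one (h (p t) (r t) (a t)) (p t) (y t))).2,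
    (abs_le.1 (S.abs_U_le_one (a t) (p t) (y t))).1]

section Regret

variable [Fintype A] {T : ℕ} (L : AgentAlg A Y T) (y : Fin T → Y)

theorem principalValue_eq (p : Fin T → Policy) (r : Fin T → A) :
    S.principalValue L y p r =
      (1 / (T : ℝ)) * L.expect y p r fun a => ∑ t, S.V (a t) (p t) (y t) :=
  L.expect_const_mul y p r _ _

theorem principalValue_mem_Icc [Nonempty A] (p : Fin T → Policy) (r : Fin T → A) :
    S.principalValue L y p r ∈ Set.Icc (0 : ℝ) 1 := by
  have hV : ∀ a : Fin T → A, (1 / (T : ℝ)) * ∑ t, S.V (a t) (p t) (y t) ∈ Set.Icc (0 : ℝ) 1 := by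
    intro a
    refine ⟨mul_nonneg (by positivity) (Finset.sum_nonneg fun t _ => (S.V_mem_Icc _ _ _).1), ?_⟩
    rw [one_div_mul_eq_div]
    refine div_le_one_of_le₀ ?_ (Nat.cast_nonneg T)
    simpa using Finset.sum_le_card_nsmul Finset.univ _ (1 : ℝ) fun t _ =>
      (S.V_mem_Icc (a t) (p t) (y t)).2
  constructor
  · exact (L.expect_const y p r 0).ge.trans (L.expect_mono fun a => (hV a).1)
  · exact (L.expect_mono fun a => (hV a).2).trans (L.expect_const y p r 1).le

theorem measurable_principalValue_policy (r : Fin T → A) :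
    Measurable fun p => S.principalValue L y p r := by
  have hV : ∀ a : Fin T → A, Measurable fun p : Fin T → Policy =>
      ∑ t, S.V (a t) (p t) (y t) := fun a =>
    Finset.measurable_fun_sum _ fun t _ =>
      (S.measurable_V (a t) (y t)).comp (measurable_pi_apply t)
  simp only [principalValue, AgentAlg.expect]
  exact Finset.measurable_fun_sum _ fun a _ =>
    (L.measurable_prob y r a).mul ((hV a).const_mul _)

theorem measurable_principalValue {Ω : Type*} [MeasurableSpace Ω] {p : Ω → Fin T → Policy}
    {r : Ω → Fin T → A} (hp : Measurable p) (hr : ∀ t a, MeasurableSet {ω | r ω t = a}) :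
    Measurable fun ω => S.principalValue L y (p ω) (r ω) := by
  let _ : MeasurableSpace A := ⊤
  have hr_measurable : Measurable r :=
    measurable_pi_iff.2 fun t => measurable_to_countable' fun a => hr t a
  have hprod : Measurable fun x : (Fin T → A) × (Fin T → Policy) =>
      S.principalValue L y x.2 x.1 :=
    measurable_from_prod_countable_right (S.measurable_principalValue_policy L y)
  exact (hprod.comp (hr_measurable.prodMk hp) :)

section Relabel

variable {M : Type} [MeasurableSpace M] [Nonempty A] [Nonempty Y] {p : Fin T → Policy}
  {r : Fin T → A} {y} {Φ : Relabeling A Y M T} {C : ℝ}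

theorem swapRegret_relabel_le
    (hΦ : ∀ a (h : Policy → A → A → A),
      ∑ t, (S.U (h (p t) (r t) (Φ.apply y p r a t)) (p t) (y t) -
          S.U (Φ.apply y p r a t) (p t) (y t)) ≤
        ∑ t, (S.U (h (p t) (r t) (a t)) (p t) (y t) - S.U (a t) (p t) (y t)) + C) :
    S.swapRegret (L.relabel Φ) y p r ≤ S.swapRegret L y p r + 1 / (T : ℝ) * C := by
  unfold swapRegret
  rw [AgentAlg.expect_relabel, ← L.expect_const y p r (1 / (T : ℝ) * C), ← L.expect_add]
  refine L.expect_mono fun a => ciSup_le fun h => ?_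
  refine le_trans ?_ (add_le_add_left (le_ciSup (S.bddAbove_swap y p r a) h) _)
  rw [← mul_add]
  exact mul_le_mul_of_nonneg_left (hΦ a h) (by positivity)

theorem negRegret_relabel_le
    (hΦ : ∀ a, ∑ t, S.U (Φ.apply y p r a t) (p t) (y t) ≤ ∑ t, S.U (a t) (p t) (y t) + C) :
    S.negRegret (L.relabel Φ) y p r ≤ S.negRegret L y p r + 1 / (T : ℝ) * C := by
  unfold negRegret
  rw [AgentAlg.expect_relabel, ← mul_add, ← L.expect_const y p r C, ← L.expect_add]
  refine mul_le_mul_of_nonneg_left (L.expect_mono fun a => ?_) (by positivity)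
  linarith [hΦ a]

end Relabel

variable [Fintype Y]

theorem VanishingRegrets.relabel [Nonempty A] [Nonempty Y] {M : Type} [MeasurableSpace M]
    {S : LinearContract A Y O} {astar : S.OptimisticResponse} {σ : ∀ T, Mechanism A Y T}
    {L : ∀ T, AgentAlg A Y T} (hL : S.VanishingRegrets astar σ L)
    {Φ : ∀ T, Relabeling A Y M T} {C : ℝ}
    (hU : ∀ T y p r a, ∑ t, S.U ((Φ T).apply y p r a t) (p t) (y t) ≤
      ∑ t, S.U (a t) (p t) (y t) + C)
    (hswap : ∀ T y p r a (h : Policy → A → A → A),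
      ∑ t, (S.U (h (p t) (r t) ((Φ T).apply y p r a t)) (p t) (y t) -
          S.U ((Φ T).apply y p r a t) (p t) (y t)) ≤
        ∑ t, (S.U (h (p t) (r t) (a t)) (p t) (y t) - S.U (a t) (p t) (y t)) + C) :
    S.VanishingRegrets astar σ fun T => (L T).relabel (Φ T) := by
  obtain ⟨εswap, εneg, hεswap, hεneg, hregret⟩ := hL
  have hC : Tendsto (fun T : ℕ => 1 / (T : ℝ) * C) atTop (𝓝 0) := by
    simpa using tendsto_one_div_atTop_nhds_zero_nat.mul_const C
  refine ⟨fun T => εswap T + 1 / (T : ℝ) * C, fun T => εneg T + 1 / (T : ℝ) * C,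
    by simpa using hεswap.add hC, by simpa using hεneg.add hC, fun T y => ⟨?_, ?_⟩⟩
  · have hle := fun p r => S.swapRegret_relabel_le (L T) (hswap T y p r)
    filter_upwards [(hregret T y).1] with ω hω
    exact ⟨(hle _ _).trans (add_le_add_left hω.1 _),
      fun p₀ hp₀ => (hle _ _).trans (add_le_add_left (hω.2 p₀ hp₀) _)⟩
  · have hle := fun p r => S.negRegret_relabel_le (L T) (hU T y p r)
    filter_upwards [(hregret T y).2] with ω hω
    exact ⟨(hle _ _).trans (add_le_add_left hω.1 _),
      fun p₀ hp₀ => (hle _ _).trans (add_le_add_left (hω.2 p₀ hp₀) _)⟩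

variable {S} (astar : S.OptimisticResponse) (σ : Mechanism A Y T) (p₀ : Policy)

/-- The Principal's regret to the constant benchmark policy `p₀` in the realization `ω`. -/
def benchmarkRegret (ω : σ.Ω) : ℝ :=
  S.principalValue L y (fun _ => p₀) (constRecommendations astar σ p₀ y ω) -
    S.principalValue L y (σ.policies y ω) (σ.recommendations y ω)

theorem measurable_benchmarkRegret : Measurable (benchmarkRegret L y astar σ p₀) :=
  (S.measurable_principalValue L y measurable_const fun t a =>
      σ.measurable_forecast t _ (astar.measurableSet_eq p₀ a)).sub
    (S.measurable_principalValue L y (measurable_pi_iff.2 fun t => σ.measurable_policy t _)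
      fun t a => σ.measurableSet_recommend t _ a)

variable [Nonempty A]

theorem abs_benchmarkRegret_le_one (ω : σ.Ω) : |benchmarkRegret L y astar σ p₀ ω| ≤ 1 := by
  have hconst := S.principalValue_mem_Icc L y (fun _ => p₀)
    (constRecommendations astar σ p₀ y ω)
  have hplay := S.principalValue_mem_Icc L y (σ.policies y ω) (σ.recommendations y ω)
  rw [benchmarkRegret, abs_le]
  constructor <;> linarith [hconst.1, hconst.2, hplay.1, hplay.2]

theorem integrable_benchmarkRegret : Integrable (benchmarkRegret L y astar σ p₀) σ.law :=
  Integrable.of_bound (measurable_benchmarkRegret L y astar σ p₀).aestronglyMeasurable 1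
    (ae_of_all _ fun ω => abs_benchmarkRegret_le_one L y astar σ p₀ ω)

variable {p₀} in
theorem integral_benchmarkRegret_le_policyRegret (hp₀ : p₀ ∈ S.benchmark) :
    ∫ ω, benchmarkRegret L y astar σ p₀ ω ∂σ.law ≤ S.policyRegret astar σ L y := by
  have hle : ∀ ω, benchmarkRegret L y astar σ p₀ ω ≤
      S.benchmark.sup' S.benchmark_nonempty fun q => benchmarkRegret L y astar σ q ω := fun ω =>
    Finset.le_sup' (fun q => benchmarkRegret L y astar σ q ω) hp₀
  have hmeas : Measurable fun ω => S.benchmark.sup' S.benchmark_nonempty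
      fun q => benchmarkRegret L y astar σ q ω := by
    convert Finset.measurable_sup' S.benchmark_nonempty
      fun q _ => measurable_benchmarkRegret L y astar σ q using 1
    funext ω
    rw [Finset.sup'_apply]
  refine integral_mono (integrable_benchmarkRegret L y astar σ p₀) ?_ hle
  refine Integrable.of_bound hmeas.aestronglyMeasurable 1
    (ae_of_all _ fun ω => abs_le.2 ⟨?_, ?_⟩)
  · exact (abs_le.1 (abs_benchmarkRegret_le_one L y astar σ p₀ ω)).1.trans (hle ω)
  · exact Finset.sup'_le _ _ fun q _ => (abs_le.1 (abs_benchmarkRegret_le_one L y astar σ q ω)).2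

end Regret

end LinearContract

section Nonanticipating

variable {A Y α : Type} {T : ℕ}

/-- A sequence, generated along each state sequence, whose entry in round `t` is determined by
the states before round `t`. -/
def Nonanticipating (s : (Fin T → Y) → Fin T → α) : Prop :=
  ∀ t, DependsOn (fun y => s y t) (past t)

theorem Nonanticipating.eqOn {s : (Fin T → Y) → Fin T → α} (hs : Nonanticipating s) {t : Fin T}
    {y y' : Fin T → Y} (hy : Set.EqOn y y' (past t)) : Set.EqOn (s y) (s y') (past (t + 1)) :=
  fun i hi => hs i fun _ hj => hy (past_mono (Nat.le_of_lt_succ hi) hj)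

theorem nonanticipating_const (s : Fin T → α) : Nonanticipating fun _ : Fin T → Y => s :=
  fun _ _ _ _ => rfl

theorem nonanticipating_comp_take (f : (t : Fin T) → (Fin t → Y) → α) :
    Nonanticipating fun y t => f t (Fin.take t t.isLt.le y) :=
  fun t y y' hy =>
    have hy : Set.EqOn y y' (past t) := fun i hi => hy i hi
    congrArg (f t) (take_eq_of_eqOn hy _)

theorem AgentAlg.expect_expect_sum_mul_eq_zero [Fintype A] [Nonempty A] [Fintype Y]
    (L : AgentAlg A Y T) {p : (Fin T → Y) → Fin T → Policy} {r : (Fin T → Y) → Fin T → A}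
    (hp : Nonanticipating p) (hr : Nonanticipating r) {ξ : Y → ℝ} (hξ : ∑ x, ξ x = 0)
    {X : Fin T → (Fin T → Y) → (Fin T → A) → ℝ}
    (hX : ∀ (t : Fin T) y y' a a', Set.EqOn y y' (past t) → Set.EqOn a a' (past (t + 1)) →
      X t y a = X t y' a') :
    𝔼 y, L.expect y (p y) (r y) (fun a => ∑ t, X t y a * ξ (y t)) = 0 := by
  classical
  have hround : ∀ t, ∑ y, L.expect y (p y) (r y) (fun a => X t y a * ξ (y t)) = 0 := by
    intro t
    let G y := L.expect y (p y) (r y) (X t y)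
    have hG : ∀ y x, G (Function.update y t x) = G y := by
      intro y x
      have hy := eqOn_past_update y t x
      refine (L.expect_congr t hy (hp.eqOn hy) (hr.eqOn hy) fun a a' ha =>
        hX t _ _ _ _ (Set.eqOn_refl _ _) fun i hi => ha i hi).trans ?_
      exact congrArg _ (funext fun a => hX t _ _ _ _ hy (Set.eqOn_refl a _))
    have hupdate : ∀ y : Fin T → Y, ∑ x, ξ (Function.update y t x t) = ∑ _x : Y, 0 := by
      intro y
      simpa only [Function.update_self, Finset.sum_const_zero] using hξ
    calc ∑ y, L.expect y (p y) (r y) (fun a => X t y a * ξ (y t))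
        = ∑ y, G y * ξ (y t) := Finset.sum_congr rfl fun y _ => by
          simp only [G, mul_comm _ (ξ (y t)), L.expect_const_mul]
      _ = ∑ y, G y * 0 := sum_mul_congr_of_sum_update_eq t hG hupdate
      _ = 0 := by simp only [mul_zero, Finset.sum_const_zero]
  rw [Finset.expect_eq_sum_div_card]
  simp only [L.expect_sum]
  rw [Finset.sum_comm, Finset.sum_eq_zero fun t _ => hround t, zero_div]

end Nonanticipating

section PolicyFrequency

variable {T : ℕ}

/-- The fraction of rounds in which the policy is `q`. -/
def policyFreq (q : Policy) (p : Fin T → Policy) : ℝ :=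
  1 / (T : ℝ) * ∑ t, if p t = q then 1 else 0

theorem sum_policyFreq_le_one (s : Finset Policy) (p : Fin T → Policy) :
    ∑ q ∈ s, policyFreq q p ≤ 1 := by
  have hround : ∀ t, ∑ q ∈ s, (if p t = q then (1 : ℝ) else 0) ≤ 1 := by
    intro t
    rw [Finset.sum_ite_eq]
    split_ifs <;> norm_num
  simp only [policyFreq]
  rw [← Finset.mul_sum, Finset.sum_comm, one_div_mul_eq_div]
  refine div_le_one_of_le₀ ?_ (Nat.cast_nonneg T)
  simpa using Finset.sum_le_card_nsmul Finset.univ _ 1 fun t _ => hround t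

end PolicyFrequency

section WorkContract

/-- The higher one of two benchmark policies slightly above the cost of working. -/
def highPolicy : Policy :=
  ⟨5 / 8, by norm_num, by norm_num⟩

/-- The lower one of two benchmark policies slightly above the cost of working. -/
def lowPolicy : Policy :=
  ⟨9 / 16, by norm_num, by norm_num⟩

/-- The linear contract setting in which the Agent works (action `1`, at cost `1/2`) or shirks
(action `0`, for free), and succeeds (outcome `1`) if it works in the good state `1`. -/
def workContract : LinearContract (Fin 2) (Fin 2) (Fin 2) where
  outcome a y := if a = 1 ∧ y = 1 then 1 else 0
  value o := if o = 1 then 1 else 0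
  value_mem o := by split_ifs <;> simp
  cost a := if a = 1 then 1 / 2 else 0
  cost_mem a := by split_ifs <;> norm_num
  cost_injective a b := by fin_cases a <;> fin_cases b <;> simp
  benchmark := {highPolicy, lowPolicy}
  benchmark_nonempty := Finset.insert_nonempty _ _

theorem card_benchmark_workContract : workContract.benchmark.card = 2 := by
  refine Finset.card_pair fun h => ?_
  have hcoe := congrArg Subtype.val h
  norm_num [highPolicy, lowPolicy] at hcoe

theorem mem_Icc_of_mem_benchmark {q : Policy} (hq : q ∈ workContract.benchmark) :
    (q : ℝ) ∈ Set.Icc (1 / 2) (5 / 8) := by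
  obtain rfl | rfl : q = highPolicy ∨ q = lowPolicy := by simpa [workContract] using hq
  · norm_num [highPolicy]
  · norm_num [lowPolicy]

/-- The Agent's utility from working, in excess of shirking. -/
def workGain (p : Policy) (y : Fin 2) : ℝ :=
  (if y = 1 then (p : ℝ) else 0) - 1 / 2

/-- The welfare from working; it vanishes on average over the two states. -/
def workWelfare (y : Fin 2) : ℝ :=
  (if y = 1 then 1 else 0) - 1 / 2

theorem workContract_U (a : Fin 2) (p : Policy) (y : Fin 2) :
    workContract.U a p y = if a = 1 then workGain p y else 0 := by
  fin_cases a <;> fin_cases y <;> simp [LinearContract.U, workContract, workGain]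

theorem workContract_V (a : Fin 2) (p : Policy) (y : Fin 2) :
    workContract.V a p y = if a = 1 ∧ y = 1 then 1 - (p : ℝ) else 0 := by
  fin_cases a <;> fin_cases y <;> simp [LinearContract.V, workContract]

theorem workContract_V_add_U (a : Fin 2) (p : Policy) (y : Fin 2) :
    workContract.V a p y + workContract.U a p y = if a = 1 then workWelfare y else 0 := by
  rw [LinearContract.V_add_U]
  fin_cases a <;> fin_cases y <;> simp [workContract, workWelfare]

theorem abs_workGain_le (p : Policy) (y : Fin 2) : |workGain p y| ≤ 1 / 2 := by
  rw [workGain, abs_le]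
  split_ifs <;> constructor <;> linarith [p.2.1, p.2.2]

theorem abs_workWelfare_le (y : Fin 2) : |workWelfare y| ≤ 1 / 2 := by
  rw [workWelfare, abs_le]
  split_ifs <;> norm_num

theorem sum_workWelfare : ∑ y, workWelfare y = 0 := by
  norm_num [workWelfare]

end WorkContract

section InformedRelabeling

/-- The condition under which an Agent that expects the state `x` switches from shirking to
working, for the ledger `l` of past gains from switching under each recommendation. It switches
only if the policy is `q`, and it works in the bad state whenever the ledger is positive. The
bound on the ledger matters only if past expectations have failed. -/
def SwitchCond (q : Policy) (x : Fin 2) (p : Policy) (r a : Fin 2) (l : Fin 2 → ℝ) : Prop :=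
  p = q ∧ a = 0 ∧ |l r| ≤ 1 / 2 ∧ (x = 1 ↔ l r ≤ 0)

instance (q : Policy) (x : Fin 2) (p : Policy) (r a : Fin 2) (l : Fin 2 → ℝ) :
    Decidable (SwitchCond q x p r a l) :=
  Classical.propDecidable _

theorem measurableSet_switchCond (q : Policy) (x r a : Fin 2) :
    MeasurableSet {m : Policy × (Fin 2 → ℝ) | SwitchCond q x m.1 r a m.2} := by
  have hledger : Measurable fun m : Policy × (Fin 2 → ℝ) => m.2 r :=
    (measurable_pi_apply r).comp measurable_snd
  exact (measurable_fst (measurableSet_singleton q)).inter <| (MeasurableSet.const _).inter <|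
    (measurableSet_le hledger.abs measurable_const).inter <|
    (MeasurableSet.const _).iff (measurableSet_le hledger measurable_const)

variable {T : ℕ} (q : Policy) (z : Fin T → Fin 2)

/-- The relabeling by an Agent that expects the state sequence `z`: it works instead of shirking
under `SwitchCond`, and keeps a ledger of the resulting gains. -/
def informedRelabeling : Relabeling (Fin 2) (Fin 2) (Fin 2 → ℝ) T where
  start := 0
  step t y p r a l := l + if SwitchCond q (z t) p r a l then Pi.single r (workGain q y) else 0
  out t p r a l := if SwitchCond q (z t) p r a l then 1 else a
  measurable_step t _ r a := measurable_snd.add <|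
    Measurable.ite (measurableSet_switchCond q (z t) r a) measurable_const measurable_const
  measurableSet_out t r a b :=
    Measurable.ite (measurableSet_switchCond q (z t) r a) measurable_const measurable_const
      (measurableSet_singleton b)

variable (y : Fin T → Fin 2) (p : Fin T → Policy) (r a : Fin T → Fin 2)

/-- The ledger of the informed Agent before each round and after the last one. -/
def ledger : Fin (T + 1) → Fin 2 → ℝ :=
  (informedRelabeling q z).memory y p r a

/-- The informed Agent switches from shirking to working in round `t`. -/
def Switches (t : Fin T) : Prop :=
  SwitchCond q (z t) (p t) (r t) (a t) (ledger q z y p r a t.castSucc)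

instance (t : Fin T) : Decidable (Switches q z y p r a t) :=
  Classical.propDecidable _

theorem informedRelabeling_apply (t : Fin T) :
    (informedRelabeling q z).apply y p r a t = if Switches q z y p r a t then 1 else a t :=
  rfl

theorem ledger_zero : ledger q z y p r a 0 = 0 :=
  rfl

theorem ledger_succ (t : Fin T) : ledger q z y p r a t.succ = ledger q z y p r a t.castSucc +
    if Switches q z y p r a t then Pi.single (r t) (workGain q (y t)) else 0 :=
  rfl

theorem abs_ledger_le_one (j : Fin (T + 1)) (c : Fin 2) : |ledger q z y p r a j c| ≤ 1 := by
  induction j using Fin.induction with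
  | zero => simp [ledger_zero]
  | succ t ih =>
    rw [ledger_succ, Pi.add_apply]
    split_ifs with hswitch
    · obtain rfl | hc := eq_or_ne c (r t)
      · rw [Pi.single_eq_same]
        exact (abs_add_le _ _).trans
          ((add_le_add hswitch.2.2.1 (abs_workGain_le q (y t))).trans (by norm_num))
      · rwa [Pi.single_eq_of_ne hc, add_zero]
    · rwa [Pi.zero_apply, add_zero]

variable {q y} in
theorem abs_ledger_le_half (hq : 1 / 2 ≤ (q : ℝ)) (j : Fin (T + 1)) (c : Fin 2) :
    |ledger q y y p r a j c| ≤ 1 / 2 := by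
  induction j using Fin.induction with
  | zero => simp [ledger_zero]
  | succ t ih =>
    rw [ledger_succ, Pi.add_apply]
    split_ifs with hswitch
    · obtain rfl | hc := eq_or_ne c (r t)
      · obtain ⟨-, -, -, hgood_iff⟩ := hswitch
        have hgain := abs_le.1 (abs_workGain_le q (y t))
        rw [Pi.single_eq_same]
        rw [abs_le] at ih ⊢
        by_cases hgood : y t = 1
        · have hledger := hgood_iff.1 hgood
          have hpos : 0 ≤ workGain q (y t) := by simpa [workGain, hgood] using hq
          constructor <;> linarith
        · have hledger := not_le.1 (mt hgood_iff.2 hgood)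
          have hneg : workGain q (y t) ≤ 0 := by norm_num [workGain, hgood]
          constructor <;> linarith
      · rwa [Pi.single_eq_of_ne hc, add_zero]
    · rwa [Pi.zero_apply, add_zero]

variable {q y} in
theorem switches_iff (hq : 1 / 2 ≤ (q : ℝ)) (t : Fin T) : Switches q y y p r a t ↔
    p t = q ∧ a t = 0 ∧ (y t = 1 ↔ ledger q y y p r a t.castSucc (r t) ≤ 0) :=
  and_congr_right' <| and_congr_right' <|
    and_iff_right (abs_ledger_le_half p r a hq t.castSucc (r t))

variable {q z y p r a} in
theorem ledger_congr {z' y' : Fin T → Fin 2} {p' : Fin T → Policy} {r' a' : Fin T → Fin 2}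
    (j : Fin (T + 1)) (hz : Set.EqOn z z' (past j)) (hy : Set.EqOn y y' (past j))
    (hp : Set.EqOn p p' (past j)) (hr : Set.EqOn r r' (past j)) (ha : Set.EqOn a a' (past j)) :
    ledger q z y p r a j = ledger q z' y' p' r' a' j := by
  refine Eq.trans ?_ ((informedRelabeling q z').memory_congr j hy hp hr ha)
  clear hy hp hr ha
  induction j using Fin.induction with
  | zero => rfl
  | succ t ih =>
    rw [ledger_succ, Relabeling.memory_succ, ← ih (hz.mono (past_mono (Nat.le_succ _)))]
    simp only [Switches, informedRelabeling, hz (mem_past_succ t)]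

variable {q} in
theorem sum_informedRelabeling_apply {u : Policy → Fin 2 → Fin 2 → Fin 2 → ℝ} {k : Fin 2 → ℝ}
    (hu : ∀ c x, u q c 1 x = u q c 0 x + k c * workGain q x) :
    ∑ t, u (p t) (r t) ((informedRelabeling q z).apply y p r a t) (y t) =
      ∑ t, u (p t) (r t) (a t) (y t) + ∑ c, k c * ledger q z y p r a (Fin.last T) c := by
  have hround : ∀ t, ∑ c, k c * ledger q z y p r a t.succ c =
      ∑ c, k c * ledger q z y p r a t.castSucc c +
        (u (p t) (r t) ((informedRelabeling q z).apply y p r a t) (y t) -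
          u (p t) (r t) (a t) (y t)) := by
    intro t
    rw [ledger_succ, informedRelabeling_apply]
    split_ifs with hswitch
    · simp only [hswitch.1, hswitch.2.1, hu, Pi.add_apply, mul_add, Finset.sum_add_distrib,
        Pi.single_apply, mul_ite, mul_zero, Finset.sum_ite_eq', Finset.mem_univ, if_true,
        add_sub_cancel_left]
    · simp only [add_zero, sub_self]
  have htelescope :=
    add_sum_eq_last_of_succ (g := fun j => ∑ c, k c * ledger q z y p r a j c) hround
  rw [Finset.sum_sub_distrib] at htelescope
  simp only [ledger_zero, Pi.zero_apply, mul_zero, Finset.sum_const_zero, zero_add]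
    at htelescope
  linarith

variable {q} in
theorem abs_sum_informedRelabeling_apply_sub_le {u : Policy → Fin 2 → Fin 2 → Fin 2 → ℝ}
    {k : Fin 2 → ℝ} (hu : ∀ c x, u q c 1 x = u q c 0 x + k c * workGain q x) {K : ℝ}
    (hk : ∀ c, |k c| ≤ K) :
    |∑ t, u (p t) (r t) ((informedRelabeling q z).apply y p r a t) (y t) -
      ∑ t, u (p t) (r t) (a t) (y t)| ≤ 2 * K := by
  rw [sum_informedRelabeling_apply z y p r a hu, add_sub_cancel_left]
  calc |∑ c, k c * ledger q z y p r a (Fin.last T) c|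
      ≤ ∑ c, |k c * ledger q z y p r a (Fin.last T) c| := Finset.abs_sum_le_sum_abs _ _
    _ ≤ ∑ _c : Fin 2, K := Finset.sum_le_sum fun c _ => by
      rw [abs_mul]
      exact (mul_le_of_le_one_right (abs_nonneg _) (abs_ledger_le_one q z y p r a _ c)).trans
        (hk c)
    _ = 2 * K := by simp

theorem abs_sum_U_informedRelabeling_sub_le :
    |∑ t, workContract.U ((informedRelabeling q z).apply y p r a t) (p t) (y t) -
      ∑ t, workContract.U (a t) (p t) (y t)| ≤ 2 := by
  simpa using abs_sum_informedRelabeling_apply_sub_le z y p r a (q := q)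
    (u := fun p _ a x => workContract.U a p x) (k := fun _ => 1) (K := 1)
    (fun _ _ => by simp [workContract_U]) fun _ => by simp

theorem sum_swap_informedRelabeling_le (h : Policy → Fin 2 → Fin 2 → Fin 2) :
    ∑ t, (workContract.U (h (p t) (r t) ((informedRelabeling q z).apply y p r a t)) (p t) (y t) -
        workContract.U ((informedRelabeling q z).apply y p r a t) (p t) (y t)) ≤
      ∑ t, (workContract.U (h (p t) (r t) (a t)) (p t) (y t) -
        workContract.U (a t) (p t) (y t)) + 4 := by
  let k c : ℝ := (if h q c 1 = 1 then 1 else 0) - (if h q c 0 = 1 then 1 else 0) - 1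
  have hk : ∀ c, |k c| ≤ 2 := by
    intro c
    simp only [k]
    split_ifs <;> norm_num
  have hle := abs_sum_informedRelabeling_apply_sub_le z y p r a (q := q)
    (u := fun p c a x => workContract.U (h p c a) p x - workContract.U a p x) (k := k)
    (fun c x => ?_) hk
  · linarith [(abs_le.1 hle).2]
  · simp only [k, workContract_U, if_true, zero_ne_one, if_false]
    split_ifs <;> ring

end InformedRelabeling

section InformedAgent

open LinearContract

variable {T : ℕ} (L : AgentAlg (Fin 2) (Fin 2) T) (q : Policy)

/-- The algorithm `L` made to work more often, in rounds with policy `q`, by the knowledge that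
the state sequence is `z`. -/
def informedAgent (z : Fin T → Fin 2) : AgentAlg (Fin 2) (Fin 2) T :=
  L.relabel (informedRelabeling q z)

theorem vanishingRegrets_informedAgent {astar : workContract.OptimisticResponse}
    {σ : ∀ T, Mechanism (Fin 2) (Fin 2) T} {L : ∀ T, AgentAlg (Fin 2) (Fin 2) T}
    (hL : workContract.VanishingRegrets astar σ L) (q : ℕ → Policy) (z : ∀ T, Fin T → Fin 2) :
    workContract.VanishingRegrets astar σ fun T => informedAgent (L T) (q T) (z T) := by
  refine hL.relabel (C := 4) (fun T y p r a => ?_) fun T y p r a h =>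
    sum_swap_informedRelabeling_le (q T) (z T) y p r a h
  linarith [(abs_le.1 (abs_sum_U_informedRelabeling_sub_le (q T) (z T) y p r a)).2]

theorem neg_expect_U_le_swapRegret (y : Fin T → Fin 2) (p : Fin T → Policy)
    (r : Fin T → Fin 2) :
    1 / (T : ℝ) * L.expect y p r (fun a => -∑ t, workContract.U (a t) (p t) (y t)) ≤
      workContract.swapRegret L y p r := by
  unfold swapRegret
  rw [← L.expect_const_mul]
  refine L.expect_mono fun a => ?_
  refine le_trans (le_of_eq ?_) (le_ciSup (workContract.bddAbove_swap y p r a) fun _ _ _ => 0)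
  simp [workContract_U]

theorem sum_V_informedRelabeling_le (z y : Fin T → Fin 2) (p : Fin T → Policy)
    (r a : Fin T → Fin 2) :
    ∑ t, workContract.V ((informedRelabeling q z).apply y p r a t) (p t) (y t) ≤
      -∑ t, workContract.U (a t) (p t) (y t) +
      (∑ t, (if p t = q then 1 / 2 else if a t = 1 then 1 else 0) * workWelfare (y t) +
      (1 / 4 * ∑ t, (if p t = q then 1 else 0) + 2)) := by
  have hwelfare : ∀ t, workContract.V ((informedRelabeling q z).apply y p r a t) (p t) (y t) +
        workContract.U ((informedRelabeling q z).apply y p r a t) (p t) (y t) ≤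
      (if p t = q then 1 / 2 else if a t = 1 then 1 else 0) * workWelfare (y t) +
        1 / 4 * if p t = q then 1 else 0 := by
    intro t
    rw [workContract_V_add_U]
    by_cases hpolicy : p t = q
    · have hbound := abs_le.1 (abs_workWelfare_le (y t))
      simp only [hpolicy, if_true]
      split_ifs <;> linarith
    · have hkeep : ¬Switches q z y p r a t := fun hswitch => hpolicy hswitch.1
      simp only [hpolicy, if_false, informedRelabeling_apply, hkeep]
      split_ifs <;> linarith
  have hsum := Finset.sum_le_sum fun t (_ : t ∈ Finset.univ) => hwelfare t
  simp only [Finset.sum_add_distrib, ← Finset.mul_sum] at hsum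
  linarith [(abs_le.1 (abs_sum_U_informedRelabeling_sub_le q z y p r a)).1]

theorem expect_principalValue_informedAgent_le {p : (Fin T → Fin 2) → Fin T → Policy}
    {r : (Fin T → Fin 2) → Fin T → Fin 2} (hp : Nonanticipating p) (hr : Nonanticipating r)
    {ε : ℝ} (hL : ∀ y, workContract.swapRegret L y (p y) (r y) ≤ ε) :
    𝔼 y, workContract.principalValue (informedAgent L q y) y (p y) (r y) ≤
      ε + 1 / 4 * 𝔼 y, policyFreq q (p y) + 2 / T := by
  let X t (y a : Fin T → Fin 2) : ℝ := if p y t = q then 1 / 2 else if a t = 1 then 1 else 0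
  let N y := L.expect y (p y) (r y) fun a => ∑ t, X t y a * workWelfare (y t)
  have hN : 𝔼 y, N y = 0 := by
    refine L.expect_expect_sum_mul_eq_zero hp hr sum_workWelfare fun t y y' a a' hy ha => ?_
    simp only [X, hp.eqOn hy (mem_past_succ t), ha (mem_past_succ t)]
  have hstate : ∀ y, workContract.principalValue (informedAgent L q y) y (p y) (r y) ≤
      ε + 1 / 4 * policyFreq q (p y) + 2 / T + 1 / T * N y := by
    intro y
    have hV := L.expect_mono (y := y) (p := p y) (r := r y)
      (sum_V_informedRelabeling_le q y y (p y) (r y))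
    rw [L.expect_add, L.expect_add, L.expect_const] at hV
    have hregret := (neg_expect_U_le_swapRegret L y (p y) (r y)).trans (hL y)
    rw [principalValue_eq, informedAgent, AgentAlg.expect_relabel]
    refine (mul_le_mul_of_nonneg_left hV (by positivity)).trans ?_
    calc _ = 1 / (T : ℝ) * L.expect y (p y) (r y)
              (fun a => -∑ t, workContract.U (a t) (p y t) (y t)) +
            1 / 4 * policyFreq q (p y) + 2 / T + 1 / T * N y := by
          simp only [policyFreq, N, X]
          ring
      _ ≤ _ := by gcongr
  calc _ ≤ 𝔼 y, (ε + 1 / 4 * policyFreq q (p y) + 2 / T + 1 / T * N y) :=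
        Finset.expect_le_expect fun y _ => hstate y
    _ = _ := by
      simp only [Finset.expect_add_distrib, ← Finset.mul_expect, hN,
        Finset.expect_const Finset.univ_nonempty, mul_zero, add_zero]

/-- The coefficient of the welfare noise in the Principal's utility under the constant policy `q`
when the Agent knows the states. -/
def constWelfareCoeff (y r a : Fin T → Fin 2) (t : Fin T) : ℝ :=
  if a t = 1 then 2 * q else
    if ledger q y y (fun _ => q) r a t.castSucc (r t) ≤ 0 then 1 else -1

variable {q}

theorem le_sum_V_informedRelabeling_const (hq : 1 / 2 ≤ (q : ℝ)) (y r a : Fin T → Fin 2) :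
    (1 - (q : ℝ)) * (∑ t, constWelfareCoeff q y r a t * workWelfare (y t) + (T / 2 - 4)) ≤
      2 * q * ∑ t, workContract.V
        ((informedRelabeling q y).apply y (fun _ => q) r a t) q (y t) := by
  set b := (informedRelabeling q y).apply y (fun _ => q) r a with hb
  have hq_le : 0 ≤ 1 - (q : ℝ) := sub_nonneg.2 q.2.2
  have hexcess : 0 ≤ (1 - (q : ℝ)) * (q - 1 / 2) := mul_nonneg hq_le (sub_nonneg.2 hq)
  -- The two sides agree if `a t = 0`, and differ by `hexcess` if `a t = 1`.
  have hround : ∀ t, (1 - (q : ℝ)) * (constWelfareCoeff q y r a t * workWelfare (y t) + 1 / 2 +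
      2 * (workContract.U (b t) q (y t) - workContract.U (a t) q (y t))) ≤
        2 * q * workContract.V (b t) q (y t) := by
    intro t
    simp only [hb, informedRelabeling_apply, switches_iff _ _ _ hq, constWelfareCoeff,
      workContract_U, workContract_V, workGain, workWelfare]
    obtain ha | ha : a t = 0 ∨ a t = 1 := by omega
    all_goals
      by_cases hy : y t = 1 <;>
      by_cases hl : ledger q y y (fun _ => q) r a t.castSucc (r t) ≤ 0 <;>
      simp only [ha, hy, hl, zero_ne_one, one_ne_zero, ite_self, if_true, if_false, and_true,
        and_false, true_iff, false_iff, not_true] <;>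
      linarith
  have hsum := Finset.sum_le_sum fun t (_ : t ∈ Finset.univ) => hround t
  simp only [Finset.sum_add_distrib, Finset.sum_sub_distrib, ← Finset.mul_sum, Finset.sum_const,
    Finset.card_univ, Fintype.card_fin, nsmul_eq_mul] at hsum
  refine le_trans (mul_le_mul_of_nonneg_left ?_ hq_le) hsum
  linarith [(abs_le.1 (abs_sum_U_informedRelabeling_sub_le q y y (fun _ => q) r a)).1]

theorem le_expect_principalValue_informedAgent_const (hT : 0 < T)
    (hq : (q : ℝ) ∈ Set.Icc (1 / 2) (5 / 8)) {r : (Fin T → Fin 2) → Fin T → Fin 2}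
    (hr : Nonanticipating r) : 3 / 20 - 2 / T ≤
      𝔼 y, workContract.principalValue (informedAgent L q y) y (fun _ => q) (r y) := by
  let N y := L.expect y (fun _ => q) (r y) fun a =>
    ∑ t, constWelfareCoeff q y (r y) a t * workWelfare (y t)
  have hN : 𝔼 y, N y = 0 := by
    refine L.expect_expect_sum_mul_eq_zero (nonanticipating_const _) hr sum_workWelfare
      (X := fun t y a => constWelfareCoeff q y (r y) a t) fun t y y' a a' hy ha => ?_
    have hpast : (past t : Set (Fin T)) ⊆ past (t + 1) := past_mono (Nat.le_succ _)
    have hrec := hr.eqOn hy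
    simp only [constWelfareCoeff, ha (mem_past_succ t), hrec (mem_past_succ t),
      ledger_congr t.castSucc hy hy (Set.eqOn_refl _ _) (hrec.mono hpast) (ha.mono hpast)]
  have hstate : ∀ y, 1 / (T : ℝ) * ((1 - q) * (N y + (T / 2 - 4))) ≤
      2 * q * workContract.principalValue (informedAgent L q y) y (fun _ => q) (r y) := by
    intro y
    have hV := L.expect_mono (y := y) (p := fun _ => q) (r := r y)
      (le_sum_V_informedRelabeling_const hq.1 y (r y))
    rw [L.expect_const_mul, L.expect_const_mul, L.expect_add, L.expect_const] at hV
    rw [principalValue_eq, informedAgent, AgentAlg.expect_relabel, mul_left_comm (2 * (q : ℝ))]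
    exact mul_le_mul_of_nonneg_left hV (by positivity)
  have hmean := Finset.expect_le_expect fun y (_ : y ∈ Finset.univ) => hstate y
  simp only [← Finset.mul_expect, Finset.expect_add_distrib, hN,
    Finset.expect_const Finset.univ_nonempty, zero_add] at hmean
  have hT' : (0 : ℝ) < T := Nat.cast_pos.2 hT
  have hfactor : 1 / (T : ℝ) * ((1 - q) * (T / 2 - 4)) = (1 - q) * (1 / 2 - 2 * (2 / T)) := by
    field_simp
    ring
  rw [hfactor] at hmean
  have herror : (0 : ℝ) ≤ 2 / T := by positivity
  nlinarith [hq.1, hq.2]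

end InformedAgent

section Separation

open LinearContract

variable {T : ℕ} (L : AgentAlg (Fin 2) (Fin 2) T)

theorem expect_policyFreq_benchmark_le_half (p : Fin T → Policy) :
    𝔼 q ∈ workContract.benchmark, policyFreq q p ≤ 1 / 2 := by
  rw [Finset.expect_eq_sum_div_card, card_benchmark_workContract]
  exact div_le_div_of_nonneg_right (sum_policyFreq_le_one _ p) (by norm_num)

theorem le_expect_principalValue_sub_informedAgent (hT : 0 < T)
    {p : (Fin T → Fin 2) → Fin T → Policy} {r : (Fin T → Fin 2) → Fin T → Fin 2}
    {rconst : Policy → (Fin T → Fin 2) → Fin T → Fin 2} (hp : Nonanticipating p)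
    (hr : Nonanticipating r) (hrconst : ∀ q, Nonanticipating (rconst q)) {ε : ℝ}
    (hL : ∀ y, workContract.swapRegret L y (p y) (r y) ≤ ε) :
    1 / 40 - ε - 4 / T ≤ 𝔼 q ∈ workContract.benchmark, 𝔼 y,
      (workContract.principalValue (informedAgent L q y) y (fun _ => q) (rconst q y) -
        workContract.principalValue (informedAgent L q y) y (p y) (r y)) := by
  have hpolicy : ∀ q ∈ workContract.benchmark,
      3 / 20 - 2 / (T : ℝ) - (ε + 1 / 4 * 𝔼 y, policyFreq q (p y) + 2 / T) ≤ 𝔼 y,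
        (workContract.principalValue (informedAgent L q y) y (fun _ => q) (rconst q y) -
          workContract.principalValue (informedAgent L q y) y (p y) (r y)) := by
    intro q hq
    rw [Finset.expect_sub_distrib]
    exact sub_le_sub
      (le_expect_principalValue_informedAgent_const L hT (mem_Icc_of_mem_benchmark hq)
        (hrconst q))
      (expect_principalValue_informedAgent_le L q hp hr hL)
  have hfreq : 𝔼 q ∈ workContract.benchmark, 𝔼 y, policyFreq q (p y) ≤ 1 / 2 := by
    rw [Finset.expect_comm]
    exact Finset.expect_le Finset.univ_nonempty fun y _ =>
      expect_policyFreq_benchmark_le_half (p y)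
  have hmean := Finset.expect_le_expect hpolicy
  simp only [Finset.expect_sub_distrib, Finset.expect_add_distrib, ← Finset.mul_expect,
    Finset.expect_const workContract.benchmark_nonempty] at hmean ⊢
  have herror : 4 / (T : ℝ) = 2 / T + 2 / T := by ring
  linarith

theorem exists_le_policyRegret_informedAgent (hT : 0 < T)
    (astar : workContract.OptimisticResponse) (σ : Mechanism (Fin 2) (Fin 2) T) {ε : ℝ}
    (hL : ∀ y, workContract.NoContextualSwapRegret astar σ L y ε) :
    ∃ q y, 1 / 40 - ε - 4 / T ≤ workContract.policyRegret astar σ (informedAgent L q y) y := by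
  have hmean : ∀ᵐ ω ∂σ.law, 1 / 40 - ε - 4 / (T : ℝ) ≤
      𝔼 x ∈ workContract.benchmark ×ˢ (Finset.univ : Finset (Fin T → Fin 2)),
        benchmarkRegret (informedAgent L x.1 x.2) x.2 astar σ x.1 ω := by
    filter_upwards [ae_all_iff.2 hL] with ω hω
    rw [Finset.expect_product]
    exact le_expect_principalValue_sub_informedAgent L hT
      (nonanticipating_comp_take fun t y => σ.policy t y ω)
      (nonanticipating_comp_take fun t y => σ.recommend t y ω)
      (fun q => nonanticipating_comp_take fun t y => astar.toFun q (σ.forecast t y ω))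
      fun y => (hω y).1
  obtain ⟨⟨q, y⟩, hqy, hle⟩ := exists_le_integral_of_ae_le_expect
    (workContract.benchmark_nonempty.product Finset.univ_nonempty)
    (fun x _ => integrable_benchmarkRegret _ x.2 astar σ x.1) hmean
  exact ⟨q, y, hle.trans <| integral_benchmarkRegret_le_policyRegret _ y astar σ
    (Finset.mem_product.1 hqy).1⟩

theorem exists_vanishingRegrets_eventually_le_policyRegret
    {astar : workContract.OptimisticResponse} {σ : ∀ T, Mechanism (Fin 2) (Fin 2) T}
    {L : ∀ T, AgentAlg (Fin 2) (Fin 2) T} (hL : workContract.VanishingRegrets astar σ L) :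
    ∃ L' : ∀ T, AgentAlg (Fin 2) (Fin 2) T, workContract.VanishingRegrets astar σ L' ∧
      ∀ᶠ T in atTop, ∃ y, 1 / 80 ≤ workContract.policyRegret astar (σ T) (L' T) y := by
  obtain ⟨ε, _, hε, -, hregret⟩ := id hL
  have hpointwise : ∀ T, ∃ q y, 0 < T → 1 / 40 - ε T - 4 / T ≤
      workContract.policyRegret astar (σ T) (informedAgent (L T) q y) y := by
    intro T
    rcases T.eq_zero_or_pos with hT | hT
    · exact ⟨highPolicy, fun _ => 0, fun hpos => absurd hT hpos.ne'⟩
    · obtain ⟨q, y, hqy⟩ := exists_le_policyRegret_informedAgent (L T) hT astar (σ T)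
        fun y => (hregret T y).1
      exact ⟨q, y, fun _ => hqy⟩
  choose q y hqy using hpointwise
  refine ⟨_, vanishingRegrets_informedAgent hL q y, ?_⟩
  have herror : Tendsto (fun T : ℕ => ε T + 4 / (T : ℝ)) atTop (𝓝 0) := by
    simpa using hε.add (tendsto_const_div_atTop_nhds_zero_nat 4)
  filter_upwards [herror.eventually_lt_const (by norm_num : (0 : ℝ) < 1 / 80),
    eventually_gt_atTop 0] with T hsmall hT
  exact ⟨y T, by linarith [hqy T hT]⟩

end Separation

end

theorem proposition3 :
    ∃ (S : LinearContract (Fin 2) (Fin 2) (Fin 2)) (c : ℝ), 0 < c ∧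
      ∀ (astar : S.OptimisticResponse) (σ : ∀ T : ℕ, Mechanism (Fin 2) (Fin 2) T),
        (¬ ∃ L : ∀ T : ℕ, AgentAlg (Fin 2) (Fin 2) T, S.VanishingRegrets astar σ L) ∨
        (∃ L : ∀ T : ℕ, AgentAlg (Fin 2) (Fin 2) T, S.VanishingRegrets astar σ L ∧
          ∀ᶠ T : ℕ in atTop, ∃ y : Fin T → Fin 2, c ≤ S.policyRegret astar (σ T) (L T) y) :=
  ⟨workContract, 1 / 80, by norm_num, fun _ _ => or_iff_not_imp_left.2 fun hexists =>
    let ⟨_, hL⟩ := not_not.1 hexists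
    exists_vanishingRegrets_eventually_le_policyRegret hL⟩
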